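/- Let $n\ge 0$, let $\Omega\subset\mathbb C^n$ be an open set (not necessarily connected or bounded), and let $F\subset\partial\Omega$ be a closed set. Assume that: 1. $\partial\Omega$ is $\mathcal C^2$-smooth near $F$, i.e. every $a\in F$ has an open neighbourhood $U$ on which there is a real-valued function $\rho\in\mathcal C^2(U)$ with $d\rho\ne 0$ at every point of $U$ and $\Omega\cap U=\{z\in U:\rho(z)<0\}$; 2. $\partial\Omega\setminus F$ is locally pseudoconvex, i.e. for every $\zeta\in\partial\Omega\setminus F$ there is $r>0$ such that $B(\zeta,r)\cap\Omega$ is pseudoconvex, where $B(\zeta,r)$ is the open Euclidean ball; 3. $F$ has empty interior relative to $\partial\Omega$. Then $\Omega$ is pseudoconvex. Here an open set $D\subset\mathbb C^n$ is called pseudoconvex if there is a continuous plurisubharmonic function $u:D\to\mathbb R$ such that $\{z\in D: u(z)\le c\}$ is compact for every $c\in\mathbb R$. -/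

import Mathlib

open Set Topology

/-- A real-valued function `u` is continuous and plurisubharmonic on the open set `Ω ⊆ ℂⁿ`: it is
continuous there and satisfies the sub-mean value inequality on every closed affine complex disc
`{z + ζ w : |ζ| ≤ 1}` contained in `Ω` (`circleAverage` is the mean over the circle `|ζ| = 1`). -/
def ContinuousPlurisubharmonicOn {n : ℕ} (u : EuclideanSpace ℂ (Fin n) → ℝ)
    (Ω : Set (EuclideanSpace ℂ (Fin n))) : Prop :=
  ContinuousOn u Ω ∧
    ∀ z w : EuclideanSpace ℂ (Fin n),
      (∀ ζ : ℂ, ‖ζ‖ ≤ 1 → z + ζ • w ∈ Ω) →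
        u z ≤ Real.circleAverage (fun ζ : ℂ => u (z + ζ • w)) 0 1

/-- `Ω ⊆ ℂⁿ` is a pseudoconvex open set (not necessarily connected or bounded): it is open and
carries a continuous plurisubharmonic exhaustion function. -/
def IsPseudoconvex {n : ℕ} (Ω : Set (EuclideanSpace ℂ (Fin n))) : Prop :=
  IsOpen Ω ∧
    ∃ u : EuclideanSpace ℂ (Fin n) → ℝ, ContinuousPlurisubharmonicOn u Ω ∧
      ∀ c : ℝ, IsCompact {z | z ∈ Ω ∧ u z ≤ c}

/-- The boundary of `Ω` is locally pseudoconvex at the point `ζ`: the part of `Ω` in some Euclidean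
ball around `ζ` is pseudoconvex. -/
def LocallyPseudoconvexAt {n : ℕ} (Ω : Set (EuclideanSpace ℂ (Fin n)))
    (ζ : EuclideanSpace ℂ (Fin n)) : Prop :=
  ∃ r : ℝ, 0 < r ∧ IsPseudoconvex (Metric.ball ζ r ∩ Ω)

/-- The boundary of `Ω` is `C²`-smooth near the boundary point `a`: on an open neighbourhood `U` of
`a` there is a real `C²` defining function `ρ` of `Ω` whose (real) differential has no zero. -/
def HasC2BoundaryNear {n : ℕ} (Ω : Set (EuclideanSpace ℂ (Fin n)))
    (a : EuclideanSpace ℂ (Fin n)) : Prop :=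
  ∃ (U : Set (EuclideanSpace ℂ (Fin n))) (ρ : EuclideanSpace ℂ (Fin n) → ℝ),
    IsOpen U ∧ a ∈ U ∧ ContDiffOn ℝ 2 ρ U ∧ (∀ z ∈ U, fderiv ℝ ρ z ≠ 0) ∧
      Ω ∩ U = {z | z ∈ U ∧ ρ z < 0}

/-! It suffices that `-log δ` is plurisubharmonic on Ω, where δ is the distance to the complement.
If it is not, comparing it on a bad affine disc with the real part of an entire function yields
discs `Φ t` that lie in Ω for `0 < t ≤ 1` and whose limit `Φ 0` meets ∂Ω only at the point p = `Φ 0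
0`, staying at distance at least c|τ|² from the complement
(`exists_touching_discs_of_circleAverage_lt`).

If p ∉ F, this contradicts the continuity principle for the pseudoconvex set B(p, r) ∩ Ω. That
principle needs a maximum principle on curved discs, whereas plurisubharmonicity is given only on
affine ones; doubling of variables bridges the gap.

If p ∈ F, the quadratic room makes the Levi form of a C² defining function negative in a complex
tangential direction at p, hence also at all nearby boundary points. At each of these a quadratic
disc touches ∂Ω from inside, so Ω is not locally pseudoconvex there. All boundary points near p
therefore lie in F, which has empty relative interior. -/

/-! ### Maximum principle along entire discs. -/

theorem exists_entire_quadratic_expansion {E : Type*} [NormedAddCommGroup E] [NormedSpace ℂ E]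
    [CompleteSpace E] {φ : ℂ → E} (hφ : Differentiable ℂ φ) (a : ℂ) :
    ∃ ψ : ℂ → E, Differentiable ℂ ψ ∧
      ∀ τ, φ (a + τ) = φ a + τ • deriv φ a + τ ^ 2 • ψ τ := by
  have hd : ∀ f : ℂ → E, Differentiable ℂ f → Differentiable ℂ (dslope f a) := fun f hf => by
    rw [← differentiableOn_univ] at hf ⊢
    exact (Complex.differentiableOn_dslope Filter.univ_mem).2 hf
  -- The second divided difference; `dslope` preserves entire functions by removability of the
  -- singularity.
  refine ⟨fun τ => dslope (dslope φ a) a (a + τ),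
    (hd _ (hd _ hφ)).comp (differentiable_id.const_add a), fun τ => ?_⟩
  have h1 := sub_smul_dslope φ a (a + τ)
  have h2 := sub_smul_dslope (dslope φ a) a (a + τ)
  rw [add_sub_cancel_left] at h1 h2
  rw [dslope_same] at h2
  rw [pow_two, mul_smul, h2, smul_sub, h1]
  abel

theorem circleAverage_re_of_entire {H : ℂ → ℂ} (hH : Differentiable ℂ H) :
    Real.circleAverage (fun ζ => (H ζ).re) 0 1 = (H 0).re := by
  have h := Complex.reCLM.circleAverage_comp_comm (f := H) (c := 0) (R := 1)
    (hH.continuous.continuousOn.circleIntegrable')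
  rw [hH.diffContOnCl.circleAverage] at h
  exact h

section

variable {n : ℕ} {u : EuclideanSpace ℂ (Fin n) → ℝ} {D : Set (EuclideanSpace ℂ (Fin n))}

theorem circleIntegrable_affine_of_continuousOn (hu : ContinuousOn u D)
    {z w : EuclideanSpace ℂ (Fin n)} (hzw : ∀ ζ : ℂ, ‖ζ‖ ≤ 1 → z + ζ • w ∈ D) :
    CircleIntegrable (fun ζ : ℂ => u (z + ζ • w)) 0 1 := by
  refine ContinuousOn.circleIntegrable' (hu.comp (by fun_prop) fun ζ hζ => hzw ζ ?_)
  simp at hζ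
  exact hζ.le

theorem ContinuousPlurisubharmonicOn.le_re_of_le_on_circle (hu : ContinuousPlurisubharmonicOn u D)
    {z w : EuclideanSpace ℂ (Fin n)} (hzw : ∀ ζ : ℂ, ‖ζ‖ ≤ 1 → z + ζ • w ∈ D)
    {H : ℂ → ℂ} (hH : Differentiable ℂ H)
    (hle : ∀ ζ : ℂ, ‖ζ‖ = 1 → u (z + ζ • w) ≤ (H ζ).re) : u z ≤ (H 0).re := by
  refine (hu.2 z w hzw).trans ?_
  rw [← circleAverage_re_of_entire hH]
  refine Real.circleAverage_mono (circleIntegrable_affine_of_continuousOn hu.1 hzw)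
    ((Complex.continuous_re.comp hH.continuous).continuousOn.circleIntegrable') fun ζ hζ => ?_
  simp at hζ
  exact hle ζ hζ

/-- A continuous plurisubharmonic function cannot satisfy, near a point `(ζ₀, y₀)`, the penalised
maximum condition with a strictly subharmonic term along an entire disc. -/
theorem ContinuousPlurisubharmonicOn.not_penalised_max (hu : ContinuousPlurisubharmonicOn u D)
    {φ : ℂ → EuclideanSpace ℂ (Fin n)} (hφ : Differentiable ℂ φ) {k ε : ℝ} (hk : 0 ≤ k)
    (hε : 0 < ε) {ζ₀ : ℂ} {y₀ : EuclideanSpace ℂ (Fin n)} {d : ℝ} (hd : 0 < d)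
    (hD : Metric.ball y₀ d ⊆ D)
    (hmax : ∀ ζ ∈ Metric.ball ζ₀ d, ∀ y ∈ Metric.ball y₀ d,
      u y - k * ‖φ ζ - y‖ ^ 2 + ε * ‖ζ‖ ^ 2 ≤ u y₀ - k * ‖φ ζ₀ - y₀‖ ^ 2 + ε * ‖ζ₀‖ ^ 2) :
    False := by
  obtain ⟨ψ, hψ, hexp⟩ := exists_entire_quadratic_expansion hφ ζ₀
  set v := deriv φ ζ₀
  set q := φ ζ₀ - y₀
  obtain ⟨C, hC⟩ := (isCompact_closedBall (0 : ℂ) 1).exists_bound_of_continuousOn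
    hψ.continuous.continuousOn
  have hC0 : 0 ≤ C := (norm_nonneg _).trans (hC 0 (by simp))
  -- The last condition makes the gain εr² beat the error kC²r⁴.
  obtain ⟨r, hr0, hr1, hrd, hrv, hrC⟩ : ∃ r : ℝ, 0 < r ∧ r ≤ 1 ∧ r < d ∧ r * ‖v‖ < d ∧
      k * C ^ 2 * r ^ 2 < ε := by
    have h1 : ∀ᶠ r : ℝ in 𝓝[>] 0, r ≤ 1 :=
      nhdsWithin_le_nhds (eventually_le_nhds one_pos)
    have h2 : ∀ᶠ r : ℝ in 𝓝[>] 0, r < d := nhdsWithin_le_nhds (eventually_lt_nhds hd)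
    have h3 : ∀ᶠ r : ℝ in 𝓝[>] 0, r * ‖v‖ < d := nhdsWithin_le_nhds <|
      (continuous_id.mul continuous_const).continuousAt.eventually_lt_const (by simpa using hd)
    have h4 : ∀ᶠ r : ℝ in 𝓝[>] 0, k * C ^ 2 * r ^ 2 < ε := nhdsWithin_le_nhds <|
      (by fun_prop : Continuous fun r : ℝ => k * C ^ 2 * r ^ 2).continuousAt.eventually_lt_const
        (by simpa using hε)
    have h0 : ∀ᶠ r : ℝ in 𝓝[>] 0, 0 < r := self_mem_nhdsWithin
    obtain ⟨r, hr⟩ := (h0.and (h1.and (h2.and (h3.and h4)))).exists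
    exact ⟨r, hr.1, hr.2⟩
  -- Move ζ₀ by rη and y₀ by rηv together: φ(ζ) - y changes only by E = (rη)²ψ(rη). The penalty
  -- changes by 2k Re⟨q, E⟩, a harmonic term, plus k‖E‖² ≤ kC²r⁴. Hence the maximum condition gives
  -- u ≤ Re H on the circle, although Re H(0) < u(y₀).
  let H : ℂ → ℂ := fun η =>
    2 * k * inner ℂ q (((r : ℂ) * η) ^ 2 • ψ (r * η)) - 2 * ε * (starRingEnd ℂ ζ₀ * (r * η))
      + ((u y₀ + k * C ^ 2 * r ^ 4 - ε * r ^ 2 : ℝ) : ℂ)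
  have hH : Differentiable ℂ H := by
    have : Differentiable ℂ fun η : ℂ => inner ℂ q (((r : ℂ) * η) ^ 2 • ψ (r * η)) :=
      (innerSL ℂ q).differentiable.comp
        (Differentiable.smul (f := ψ ∘ fun η : ℂ => (r : ℂ) * η)
          ((differentiable_id.const_mul (r : ℂ)).pow 2)
          (hψ.comp (differentiable_id.const_mul (r : ℂ))))
    fun_prop
  have key := hu.le_re_of_le_on_circle (z := y₀) (w := (r : ℂ) • v) (fun ζ hζ => hD ?_) hH
    fun η hη => ?_
  · simp only [H, mul_zero] at key
    rw [zero_pow two_ne_zero, zero_smul, inner_zero_right, mul_zero,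
      sub_zero, zero_add, Complex.ofReal_re] at key
    have : 0 < r ^ 2 := by positivity
    nlinarith
  · rw [mem_ball_iff_norm, add_sub_cancel_left, norm_smul, norm_smul, Complex.norm_real,
      Real.norm_of_nonneg hr0.le]
    calc ‖ζ‖ * (r * ‖v‖) ≤ 1 * (r * ‖v‖) := by gcongr
      _ < d := by linarith
  · have hnr : ‖(r : ℂ) * η‖ = r := by
      rw [norm_mul, hη, Complex.norm_real, Real.norm_of_nonneg hr0.le, mul_one]
    have h := hmax (ζ₀ + r * η) (by rwa [mem_ball_iff_norm, add_sub_cancel_left, hnr])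
      (y₀ + η • (r : ℂ) • v) (by
        rw [mem_ball_iff_norm, add_sub_cancel_left, norm_smul, norm_smul, Complex.norm_real,
          Real.norm_of_nonneg hr0.le, hη]
        linarith)
    have he : φ (ζ₀ + r * η) - (y₀ + η • (r : ℂ) • v)
        = q + ((r : ℂ) * η) ^ 2 • ψ (r * η) := by
      rw [hexp, smul_smul, mul_comm η]
      simp only [q]
      abel
    have hE : ‖((r : ℂ) * η) ^ 2 • ψ (r * η)‖ ^ 2 ≤ C ^ 2 * r ^ 4 := by
      rw [norm_smul, norm_pow, hnr]
      have := hC (r * η) (by rwa [mem_closedBall_zero_iff, hnr])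
      calc (r ^ 2 * ‖ψ (r * η)‖) ^ 2 ≤ (r ^ 2 * C) ^ 2 := by gcongr
        _ = _ := by ring
    rw [he, norm_add_sq (𝕜 := ℂ)] at h
    have h2 : ‖ζ₀ + r * η‖ ^ 2 = ‖ζ₀‖ ^ 2 + 2 * (starRingEnd ℂ ζ₀ * (r * η)).re + r ^ 2 := by
      rw [norm_add_sq (𝕜 := ℂ), hnr, RCLike.inner_apply, mul_comm (r * η : ℂ)]
      simp
    rw [h2] at h
    have h3 : (H η).re = 2 * k * (inner ℂ q (((r : ℂ) * η) ^ 2 • ψ (r * η))).re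
        - 2 * ε * (starRingEnd ℂ ζ₀ * (r * η)).re
        + (u y₀ + k * C ^ 2 * r ^ 4 - ε * r ^ 2) := by
      simp only [H, Complex.add_re, Complex.sub_re, Complex.ofReal_re]
      congr 2
      · rw [← Complex.re_ofReal_mul]; push_cast; rfl
      · rw [← Complex.re_ofReal_mul]; push_cast; rfl
    rw [h3]
    simp only [RCLike.re_to_complex] at h
    have := mul_le_mul_of_nonneg_left hE hk
    nlinarith

/-- The maximum principle for continuous plurisubharmonic functions along entire discs. -/
theorem ContinuousPlurisubharmonicOn.le_of_le_on_sphere (hu : ContinuousPlurisubharmonicOn u D)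
    (hD : IsOpen D) {φ : ℂ → EuclideanSpace ℂ (Fin n)} (hφ : Differentiable ℂ φ) {s M : ℝ}
    (hφD : MapsTo φ (Metric.closedBall 0 s) D) (hM : ∀ ζ : ℂ, ‖ζ‖ = s → u (φ ζ) ≤ M)
    {ζ₁ : ℂ} (hζ₁ : ‖ζ₁‖ ≤ s) : u (φ ζ₁) ≤ M := by
  by_contra! hlt
  have hKc : IsCompact (φ '' Metric.closedBall 0 s) :=
    (isCompact_closedBall 0 s).image hφ.continuous
  obtain ⟨d, hd, hdD⟩ := hKc.exists_cthickening_subset_open hD hφD.image_subset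
  set K := Metric.cthickening d (φ '' Metric.closedBall 0 s) with hK
  have hKcomp : IsCompact K := hKc.cthickening
  have hφK : ∀ ζ : ℂ, ‖ζ‖ ≤ s → φ ζ ∈ K := fun ζ hζ =>
    Metric.self_subset_cthickening _ ⟨ζ, by simpa using hζ, rfl⟩
  have huK : ContinuousOn u K := hu.1.mono hdD
  obtain ⟨ε, hε, hεM⟩ : ∃ ε : ℝ, 0 < ε ∧ ε * s ^ 2 + ε < u (φ ζ₁) - M := by
    refine ⟨(u (φ ζ₁) - M) / (2 * (s ^ 2 + 1)), by have := sub_pos.2 hlt; positivity, ?_⟩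
    have : 0 < u (φ ζ₁) - M := sub_pos.2 hlt
    have h2 : (u (φ ζ₁) - M) / (2 * (s ^ 2 + 1)) * (s ^ 2 + 1) = (u (φ ζ₁) - M) / 2 := by
      field_simp
    linarith
  obtain ⟨B, hB⟩ := hKcomp.exists_bound_of_continuousOn huK
  obtain ⟨γ, hγ, hγu⟩ := Metric.uniformContinuousOn_iff.1
    (hKcomp.uniformContinuousOn_of_continuous huK) ε hε
  -- The penalty k outweighs the oscillation of u, so a maximiser has y₀ so close to φ(ζ₀) that u
  -- varies by less than ε and y₀ is interior to K.
  obtain ⟨k, hk0, hk⟩ : ∃ k : ℝ, 0 ≤ k ∧ 2 * B + ε * s ^ 2 < k * (min γ d) ^ 2 := by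
    have hm : 0 < (min γ d) ^ 2 := by have := lt_min hγ hd; positivity
    have hB0 : 0 ≤ B := (norm_nonneg _).trans (hB _ (hφK ζ₁ hζ₁))
    refine ⟨(2 * B + ε * s ^ 2 + 1) / (min γ d) ^ 2, by positivity, ?_⟩
    rw [div_mul_cancel₀ _ hm.ne']
    linarith
  -- Doubling of variables: y is freed from φ(ζ), so u can be tested on affine discs in y.
  have hcont : ContinuousOn (fun p : ℂ × EuclideanSpace ℂ (Fin n) =>
      u p.2 - k * ‖φ p.1 - p.2‖ ^ 2 + ε * ‖p.1‖ ^ 2) (Metric.closedBall 0 s ×ˢ K) := by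
    have h1 : ContinuousOn (fun p : ℂ × EuclideanSpace ℂ (Fin n) => u p.2)
        (Metric.closedBall 0 s ×ˢ K) := huK.comp continuousOn_snd fun p hp => hp.2
    have h2 : Continuous fun p : ℂ × EuclideanSpace ℂ (Fin n) => φ p.1 :=
      hφ.continuous.comp continuous_fst
    have h3 : Continuous fun p : ℂ × EuclideanSpace ℂ (Fin n) => k * ‖φ p.1 - p.2‖ ^ 2 :=
      ((h2.sub continuous_snd).norm.pow 2).const_mul k
    exact (h1.sub h3.continuousOn).add (by fun_prop)
  obtain ⟨⟨ζ₀, y₀⟩, ⟨hζ₀, hy₀⟩, hmax⟩ :=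
    ((isCompact_closedBall (0 : ℂ) s).prod hKcomp).exists_isMaxOn ⟨(ζ₁, φ ζ₁), by simpa using hζ₁, hφK ζ₁ hζ₁⟩ hcont
  rw [isMaxOn_iff] at hmax
  simp only at hζ₀ hy₀
  rw [mem_closedBall_zero_iff] at hζ₀
  have h1 := hmax (ζ₁, φ ζ₁) ⟨by simpa using hζ₁, hφK ζ₁ hζ₁⟩
  simp only [sub_self, norm_zero] at h1
  have hs0 : 0 ≤ s := (norm_nonneg _).trans hζ₁
  have hsq : ‖ζ₀‖ ^ 2 ≤ s ^ 2 := by gcongr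
  have hclose : ‖φ ζ₀ - y₀‖ < min γ d := by
    by_contra! hge
    have h2 : k * (min γ d) ^ 2 ≤ k * ‖φ ζ₀ - y₀‖ ^ 2 := by
      have := lt_min hγ hd
      gcongr
    have h3 := (abs_le.1 (hB _ (hφK ζ₁ hζ₁))).1
    have h4 := (abs_le.1 (hB _ hy₀)).2
    have h5 : 0 ≤ ε * ‖ζ₁‖ ^ 2 := by positivity
    nlinarith
  -- On the boundary circle the penalised value is at most M + ε + εs², below the value at (ζ₁,
  -- φ(ζ₁)).
  have hlt : ‖ζ₀‖ < s := by
    refine lt_of_le_of_ne hζ₀ fun heq => ?_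
    have h2 := (abs_lt.1 (hγu y₀ hy₀ _ (hφK ζ₀ hζ₀)
      (by rw [dist_comm, dist_eq_norm]; exact hclose.trans_le (min_le_left _ _)))).2
    have h3 := hM ζ₀ heq
    have h4 : 0 ≤ k * ‖φ ζ₀ - y₀‖ ^ 2 := by positivity
    have h5 : 0 ≤ ε * ‖ζ₁‖ ^ 2 := by positivity
    nlinarith
  have hball : Metric.ball y₀ (d - ‖φ ζ₀ - y₀‖) ⊆ K := fun y hy =>
    Metric.mem_cthickening_of_dist_le y (φ ζ₀) d _ ⟨ζ₀, by simpa using hζ₀, rfl⟩ (by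
      rw [mem_ball_iff_norm] at hy
      rw [dist_eq_norm, ← norm_neg]
      have := norm_sub_le (φ ζ₀ - y₀) (y - y₀)
      rw [sub_sub_sub_cancel_right] at this
      rw [neg_sub]
      linarith)
  have hd' : 0 < d - ‖φ ζ₀ - y₀‖ := sub_pos.2 (hclose.trans_le (min_le_right _ _))
  refine hu.not_penalised_max hφ hk0 hε (lt_min hd' (sub_pos.2 hlt))
    (((Metric.ball_subset_ball (min_le_left _ _)).trans hball).trans hdD)
    fun ζ hζ y hy => hmax (ζ, y) ⟨?_, hball (Metric.ball_subset_ball (min_le_left _ _) hy)⟩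
  have := Metric.ball_subset_ball (min_le_right _ _) hζ
  rw [mem_ball_iff_norm] at this
  rw [mem_closedBall_zero_iff]
  have h6 := norm_sub_norm_le ζ ζ₀
  linarith

end

/-! ### The continuity principle. -/

section

variable {n : ℕ} {D Ω : Set (EuclideanSpace ℂ (Fin n))}

/-- The boundary circles of the discs sweep out a compact subset of D, on which the exhaustion is at
most some M. By the maximum principle the centres with small t > 0 lie in the sublevel set of M; it
is compact, hence contains their limit. -/
theorem IsPseudoconvex.continuity_principle (hD : IsPseudoconvex D)
    {Φ : ℝ → ℂ → EuclideanSpace ℂ (Fin n)} (hΦ : Continuous fun p : ℝ × ℂ => Φ p.1 p.2)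
    (hΦd : ∀ t, Differentiable ℂ (Φ t)) {t₀ s : ℝ} (ht₀ : 0 < t₀) (hs : 0 < s)
    (hΦD : ∀ t ∈ Icc 0 t₀, ∀ τ : ℂ, ‖τ‖ ≤ s → 0 < t ∨ τ ≠ 0 → Φ t τ ∈ D) : Φ 0 0 ∈ D := by
  obtain ⟨hopen, u, hu, hex⟩ := hD
  have hK : IsCompact ((fun p : ℝ × ℂ => Φ p.1 p.2) '' (Icc 0 t₀ ×ˢ Metric.sphere 0 s)) :=
    (isCompact_Icc.prod (isCompact_sphere 0 s)).image hΦ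
  have hne : ∀ τ : ℂ, ‖τ‖ = s → τ ≠ 0 := fun τ hτ => norm_pos_iff.1 (hτ ▸ hs)
  have hKD : (fun p : ℝ × ℂ => Φ p.1 p.2) '' (Icc 0 t₀ ×ˢ Metric.sphere 0 s) ⊆ D := by
    rintro _ ⟨⟨t, τ⟩, ⟨ht, hτ⟩, rfl⟩
    have hτ' : ‖τ‖ = s := by simpa using hτ
    exact hΦD t ht τ hτ'.le (Or.inr (hne τ hτ'))
  obtain ⟨M, hM⟩ := hK.exists_bound_of_continuousOn (hu.1.mono hKD)
  have hlim : Filter.Tendsto (fun t => Φ t 0) (𝓝[>] 0) (𝓝 (Φ 0 0)) :=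
    ((hΦ.comp (continuous_id.prodMk continuous_const)).tendsto 0).mono_left nhdsWithin_le_nhds
  refine ((hex M).isClosed.mem_of_tendsto hlim ?_).1
  filter_upwards [Ioo_mem_nhdsGT ht₀] with t ht
  have htI : t ∈ Icc 0 t₀ := ⟨ht.1.le, ht.2.le⟩
  refine ⟨hΦD t htI 0 (by simpa using hs.le) (Or.inl ht.1), ?_⟩
  refine hu.le_of_le_on_sphere hopen (hΦd t) (s := s) (fun τ hτ => ?_) (fun τ hτ => ?_)
    (by simpa using hs.le)
  · exact hΦD t htI τ (by simpa using hτ) (Or.inl ht.1)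
  · exact (le_abs_self _).trans (hM _ ⟨(t, τ), ⟨htI, by simpa using hτ⟩, rfl⟩)

/-- An open set whose boundary is locally pseudoconvex at `p` is not touched at `p` by a continuous
family of entire discs. -/
theorem LocallyPseudoconvexAt.continuity_principle {p : EuclideanSpace ℂ (Fin n)}
    (hp : LocallyPseudoconvexAt Ω p)
    {Φ : ℝ → ℂ → EuclideanSpace ℂ (Fin n)} (hΦ : Continuous fun p : ℝ × ℂ => Φ p.1 p.2)
    (hΦd : ∀ t, Differentiable ℂ (Φ t)) (hΦp : Φ 0 0 = p) {t₀ s : ℝ} (ht₀ : 0 < t₀) (hs : 0 < s)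
    (hΦD : ∀ t ∈ Icc 0 t₀, ∀ τ : ℂ, ‖τ‖ ≤ s → 0 < t ∨ τ ≠ 0 → Φ t τ ∈ Ω) : p ∈ Ω := by
  obtain ⟨r, hr, hD⟩ := hp
  have hev := hΦ.continuousAt.eventually_mem (x := ((0 : ℝ), (0 : ℂ)))
    (Metric.ball_mem_nhds (Φ 0 0) hr)
  obtain ⟨η, hη, hηb⟩ := Metric.eventually_nhds_iff_ball.1 hev
  have h := hD.continuity_principle hΦ hΦd (t₀ := min t₀ (η / 2)) (s := min s (η / 2))
    (lt_min ht₀ (by positivity)) (lt_min hs (by positivity)) fun t ht τ hτ h => ⟨?_, ?_⟩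
  · exact hΦp ▸ h.2
  · rw [← hΦp]
    refine hηb (t, τ) ?_
    rw [← ball_prod_same]
    refine ⟨?_, ?_⟩
    · have := ht.2.trans (min_le_right _ _)
      rw [mem_ball_zero_iff, Real.norm_of_nonneg ht.1]
      linarith
    · have := hτ.trans (min_le_right _ _)
      rw [mem_ball_zero_iff]
      linarith
  · exact hΦD t ⟨ht.1, ht.2.trans (min_le_left _ _)⟩ τ (hτ.trans (min_le_left _ _)) h

end

/-! ### Harmonic majorants on the circle. -/

/-- Negative frequencies are conjugates of positive powers on the circle. Consequently Re P = Re(f +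
g) there. -/
theorem exists_entire_of_mem_span_fourier {P : C(AddCircle (2 * Real.pi), ℂ)}
    (hP : P ∈ Submodule.span ℂ (range (fourier (T := 2 * Real.pi)))) :
    ∃ f g : ℂ → ℂ, Differentiable ℂ f ∧ Differentiable ℂ g ∧
      ∀ θ : ℝ, P θ = f (circleMap 0 1 θ) + starRingEnd ℂ (g (circleMap 0 1 θ)) := by
  have hcm : ∀ θ : ℝ, ∀ m : ℕ,
      fourier (T := 2 * Real.pi) (m : ℤ) θ = (circleMap 0 1 θ) ^ m := fun θ m => by
    rw [fourier_coe_apply, circleMap, Complex.ofReal_one, one_mul, zero_add, ← Complex.exp_nat_mul]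
    have : (Real.pi : ℂ) ≠ 0 := by exact_mod_cast Real.pi_ne_zero
    congr 1
    push_cast
    field_simp
  induction hP using Submodule.span_induction with
  | mem P hP =>
    obtain ⟨m, rfl⟩ := hP
    obtain ⟨m, rfl | rfl⟩ := m.eq_nat_or_neg
    · exact ⟨fun z => z ^ m, fun _ => 0, by fun_prop, by fun_prop, fun θ => by
        rw [hcm, map_zero, add_zero]⟩
    · exact ⟨fun _ => 0, fun z => z ^ m, by fun_prop, by fun_prop, fun θ => by
        rw [fourier_neg, hcm, zero_add]⟩
  | zero => exact ⟨fun _ => 0, fun _ => 0, by fun_prop, by fun_prop, by simp⟩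
  | add P Q _ _ hP hQ =>
    obtain ⟨f, g, hf, hg, h⟩ := hP
    obtain ⟨f', g', hf', hg', h'⟩ := hQ
    refine ⟨fun z => f z + f' z, fun z => g z + g' z, by fun_prop, by fun_prop, fun θ => ?_⟩
    rw [ContinuousMap.add_apply, h, h', map_add]
    ring
  | smul c P _ hP =>
    obtain ⟨f, g, hf, hg, h⟩ := hP
    refine ⟨fun z => c * f z, fun z => starRingEnd ℂ c * g z, by fun_prop, by fun_prop,
      fun θ => ?_⟩
    rw [ContinuousMap.smul_apply, h, map_mul, Complex.conj_conj, smul_eq_mul]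
    ring

/-- A continuous function on the unit circle with mean less than `A` is dominated there by the real
part of an entire function whose real part at the centre is less than `A`. -/
theorem exists_entire_re_ge_of_circleAverage_lt {b : ℂ → ℝ}
    (hb : ContinuousOn b (Metric.sphere 0 1)) {A : ℝ} (hA : Real.circleAverage b 0 1 < A) :
    ∃ f : ℂ → ℂ, Differentiable ℂ f ∧ (∀ ζ : ℂ, ‖ζ‖ = 1 → b ζ ≤ (f ζ).re) ∧ (f 0).re < A := by
  have : Fact (0 < 2 * Real.pi) := ⟨Real.two_pi_pos⟩
  -- Approximation within ε followed by an upward shift of ε raises the mean by at most 2ε.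
  set ε := (A - Real.circleAverage b 0 1) / 3 with hε
  have hε0 : 0 < ε := by rw [hε]; linarith
  have hbc : Continuous fun θ : ℝ => (b (circleMap 0 1 θ) : ℂ) :=
    Complex.continuous_ofReal.comp
      (hb.comp_continuous (continuous_circleMap 0 1) fun θ => by simp)
  have hper : Function.Periodic (fun θ : ℝ => (b (circleMap 0 1 θ) : ℂ)) (2 * Real.pi) :=
    fun θ => by simp only [periodic_circleMap 0 1 θ]
  let c : C(AddCircle (2 * Real.pi), ℂ) := ⟨hper.lift, continuous_coinduced_dom.2 hbc⟩
  have hc : c ∈ (Submodule.span ℂ (range (fourier (T := 2 * Real.pi)))).topologicalClosure := by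
    rw [span_fourier_closure_eq_top]; trivial
  obtain ⟨P, hP, hPc⟩ := Metric.mem_closure_iff.1 hc ε hε0
  obtain ⟨f, g, hf, hg, hfg⟩ := exists_entire_of_mem_span_fourier hP
  have hclose : ∀ ζ : ℂ, ‖ζ‖ = 1 → |b ζ - (f ζ + g ζ).re| ≤ ε := fun ζ hζ => by
    obtain ⟨θ, -, rfl⟩ : ζ ∈ circleMap 0 1 '' Ioc 0 (2 * Real.pi) := by
      rw [image_circleMap_Ioc]; simpa using hζ
    have h1 := (ContinuousMap.dist_apply_le_dist (f := c) (g := P) (θ : AddCircle (2 * Real.pi)))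
    have h2 : c (θ : AddCircle (2 * Real.pi)) = (b (circleMap 0 1 θ) : ℂ) := rfl
    rw [h2, hfg, dist_eq_norm] at h1
    have h3 := (Complex.abs_re_le_norm _).trans (h1.trans hPc.le)
    simpa using h3
  refine ⟨fun z => f z + g z + (ε : ℂ), by fun_prop, fun ζ hζ => ?_, ?_⟩
  · have := (abs_le.1 (hclose ζ hζ)).2
    rw [Complex.add_re _ (ε : ℂ), Complex.ofReal_re]
    linarith
  · have hH : Differentiable ℂ fun z => f z + g z - (ε : ℂ) := by fun_prop
    have h1 := circleAverage_re_of_entire hH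
    have h2 : Real.circleAverage (fun ζ => (f ζ + g ζ - (ε : ℂ)).re) 0 1
        ≤ Real.circleAverage b 0 1 := by
      refine Real.circleAverage_mono
        ((Complex.continuous_re.comp hH.continuous).continuousOn.circleIntegrable')
        (ContinuousOn.circleIntegrable' (by simpa using hb)) fun ζ hζ => ?_
      have := (abs_le.1 (hclose ζ (by simpa using hζ))).1
      rw [Complex.sub_re _ (ε : ℂ), Complex.ofReal_re]
      linarith
    rw [h1, Complex.sub_re _ (ε : ℂ), Complex.ofReal_re] at h2
    rw [Complex.add_re _ (ε : ℂ), Complex.ofReal_re]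
    linarith

/-! ### The distance to the complement and touching discs. -/

section

variable {n : ℕ} {Ω : Set (EuclideanSpace ℂ (Fin n))}

theorem continuousOn_neg_log_infDist_compl (hΩ : IsOpen Ω) (hne : Ωᶜ.Nonempty) :
    ContinuousOn (fun z => -Real.log (Metric.infDist z Ωᶜ)) Ω :=
  ((Metric.continuous_infDist_pt Ωᶜ).continuousOn.log fun _ hz =>
    ((hΩ.isClosed_compl.notMem_iff_infDist_pos hne).1 (not_not.2 hz)).ne').neg

/-- If a continuous function `v` violates the sub-mean value inequality on an affine disc, then along
the line of that disc it is touched from above at one point by the real part of an entire function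
minus a multiple of `|τ|²`. -/
theorem exists_strict_touching_of_circleAverage_lt
    {v : EuclideanSpace ℂ (Fin n) → ℝ} (hv : ContinuousOn v Ω)
    {z w : EuclideanSpace ℂ (Fin n)} (hzw : ∀ ζ : ℂ, ‖ζ‖ ≤ 1 → z + ζ • w ∈ Ω)
    (hlt : Real.circleAverage (fun ζ : ℂ => v (z + ζ • w)) 0 1 < v z) :
    ∃ (z₀ : EuclideanSpace ℂ (Fin n)) (g : ℂ → ℂ) (ε s : ℝ), Differentiable ℂ g ∧ 0 < ε ∧ 0 < s ∧
      v z₀ = (g 0).re ∧ ∀ τ : ℂ, ‖τ‖ ≤ s → z₀ + τ • w ∈ Ω ∧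
        v (z₀ + τ • w) ≤ (g τ).re - ε * ‖τ‖ ^ 2 := by
  have hvc : ContinuousOn (fun ζ : ℂ => v (z + ζ • w)) (Metric.closedBall 0 1) :=
    hv.comp (by fun_prop) fun ζ hζ => hzw ζ (by simpa using hζ)
  obtain ⟨f, hf, hfb, hf0⟩ := exists_entire_re_ge_of_circleAverage_lt
    (hvc.mono Metric.sphere_subset_closedBall) hlt
  -- The function maximised below equals 2ε at 0 and is at most ε on the unit circle, so its maximum
  -- is interior.
  set ε := (v z - (f 0).re) / 2 with hε
  have hε0 : 0 < ε := by rw [hε]; linarith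
  have hcont : ContinuousOn (fun ζ : ℂ => v (z + ζ • w) - (f ζ).re + ε * ‖ζ‖ ^ 2)
      (Metric.closedBall 0 1) :=
    (hvc.sub (Complex.continuous_re.comp hf.continuous).continuousOn).add (by fun_prop)
  obtain ⟨ζ₀, hζ₀, hmax⟩ := (isCompact_closedBall (0 : ℂ) 1).exists_isMaxOn ⟨0, by simp⟩ hcont
  rw [isMaxOn_iff] at hmax
  rw [mem_closedBall_zero_iff] at hζ₀
  have h0 := hmax 0 (by simp)
  simp only [zero_smul, add_zero, norm_zero] at h0
  have hζ₀1 : ‖ζ₀‖ < 1 := by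
    refine lt_of_le_of_ne hζ₀ fun h => ?_
    have := hfb ζ₀ h
    rw [h] at h0
    linarith
  set M := v (z + ζ₀ • w) - (f ζ₀).re + ε * ‖ζ₀‖ ^ 2 with hM
  -- Recentring |ζ|² at ζ₀ leaves |τ|² plus a term affine in τ; the latter is the real part of an
  -- entire function and is absorbed into g.
  refine ⟨z + ζ₀ • w, fun τ => f (ζ₀ + τ) +
    ((M - ε * ‖ζ₀‖ ^ 2 : ℝ) : ℂ) - (2 * ε : ℝ) * (starRingEnd ℂ ζ₀ * τ), ε, 1 - ‖ζ₀‖, by fun_prop,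
    hε0, by linarith, ?_, fun τ hτ => ?_⟩
  · rw [Complex.sub_re, Complex.add_re, Complex.ofReal_re, add_zero, mul_zero, mul_zero,
      Complex.zero_re]
    linarith
  · have h1 : ‖ζ₀ + τ‖ ≤ 1 := (norm_add_le _ _).trans (by linarith)
    have h2 := hmax (ζ₀ + τ) (by simpa using h1)
    have h3 : ‖ζ₀ + τ‖ ^ 2 = ‖ζ₀‖ ^ 2 + 2 * (starRingEnd ℂ ζ₀ * τ).re + ‖τ‖ ^ 2 := by
      rw [norm_add_sq (𝕜 := ℂ), RCLike.inner_apply, mul_comm τ]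
      rfl
    rw [add_assoc, ← add_smul]
    refine ⟨hzw _ h1, ?_⟩
    rw [Complex.sub_re, Complex.add_re, Complex.ofReal_re, Complex.re_ofReal_mul]
    rw [h3] at h2
    linarith

/-- Exponentiating the touching inequality gives δ(z₀ + τw) ≥ |e^{-g(τ)}|(1 + ε|τ|²), with equality
at τ = 0. Displacing z₀ + τw by e^{-g(τ)} times a fixed unit vector thus stays in Ω with quadratic
room, and at τ = 0 it can be made to hit a nearest point of the complement. -/
theorem exists_touching_discs_of_circleAverage_lt (hΩ : IsOpen Ω) (hne : Ωᶜ.Nonempty)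
    {z w : EuclideanSpace ℂ (Fin n)} (hzw : ∀ ζ : ℂ, ‖ζ‖ ≤ 1 → z + ζ • w ∈ Ω)
    (hlt : Real.circleAverage (fun ζ : ℂ => -Real.log (Metric.infDist (z + ζ • w) Ωᶜ)) 0 1
      < -Real.log (Metric.infDist z Ωᶜ)) :
    ∃ (Φ : ℝ → ℂ → EuclideanSpace ℂ (Fin n)) (c s : ℝ),
      (Continuous fun p : ℝ × ℂ => Φ p.1 p.2) ∧ (∀ t, Differentiable ℂ (Φ t)) ∧ 0 < c ∧ 0 < s ∧
      Φ 0 0 ∈ frontier Ω ∧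
      (∀ t ∈ Icc (0 : ℝ) 1, ∀ τ : ℂ, ‖τ‖ ≤ s → 0 < t ∨ τ ≠ 0 → Φ t τ ∈ Ω) ∧
      ∀ τ : ℂ, ‖τ‖ ≤ s → Metric.ball (Φ 0 τ) (c * ‖τ‖ ^ 2) ⊆ Ω := by
  obtain ⟨z₀, g, ε, s, hg, hε, hs, hg0, hgs⟩ := exists_strict_touching_of_circleAverage_lt
    (continuousOn_neg_log_infDist_compl hΩ hne) hzw hlt
  have hz₀ : z₀ ∈ Ω := by simpa using (hgs 0 (by simpa using hs.le)).1
  have hpos : ∀ x ∈ Ω, 0 < Metric.infDist x Ωᶜ := fun x hx =>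
    (hΩ.isClosed_compl.notMem_iff_infDist_pos hne).1 (not_not.2 hx)
  have hδ0 : Metric.infDist z₀ Ωᶜ = Real.exp (-(g 0).re) := by
    rw [← hg0, neg_neg, Real.exp_log (hpos _ hz₀)]
  have hδ : ∀ τ : ℂ, ‖τ‖ ≤ s →
      Real.exp (-(g τ).re) * (1 + ε * ‖τ‖ ^ 2) ≤ Metric.infDist (z₀ + τ • w) Ωᶜ := fun τ hτ => by
    obtain ⟨h1, h2⟩ := hgs τ hτ
    calc Real.exp (-(g τ).re) * (1 + ε * ‖τ‖ ^ 2)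
        ≤ Real.exp (-(g τ).re) * Real.exp (ε * ‖τ‖ ^ 2) := by
          gcongr
          have := Real.add_one_le_exp (ε * ‖τ‖ ^ 2)
          linarith
      _ = Real.exp (-(g τ).re + ε * ‖τ‖ ^ 2) := (Real.exp_add _ _).symm
      _ ≤ Real.exp (Real.log (Metric.infDist (z₀ + τ • w) Ωᶜ)) := by gcongr; linarith
      _ = _ := Real.exp_log (hpos _ h1)
  obtain ⟨p, hp, hpd⟩ := hΩ.isClosed_compl.exists_infDist_eq_dist hne z₀
  have hnexp : ∀ τ, ‖Complex.exp (-g τ)‖ = Real.exp (-(g τ).re) := fun τ => by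
    rw [Complex.norm_exp, Complex.neg_re]
  -- Normalised so that e^{-g(0)}a = p - z₀; it is a unit vector because |p - z₀| = δ(z₀) = e^{-Re
  -- g(0)}.
  set a := Complex.exp (g 0) • (p - z₀) with ha
  have ha1 : ‖a‖ = 1 := by
    rw [ha, norm_smul, Complex.norm_exp, ← dist_eq_norm, dist_comm, ← hpd, hδ0, ← Real.exp_add,
      add_neg_cancel, Real.exp_zero]
  let Φ : ℝ → ℂ → EuclideanSpace ℂ (Fin n) := fun t τ =>
    z₀ + τ • w + ((1 - t : ℝ) * Complex.exp (-g τ)) • a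
  have hΦ : Continuous fun p : ℝ × ℂ => Φ p.1 p.2 := by
    have := hg.continuous
    fun_prop
  have hΦd : ∀ t, Differentiable ℂ (Φ t) := fun t => by
    have h1 : Differentiable ℂ fun τ => ((1 - t : ℝ) * Complex.exp (-g τ)) := by fun_prop
    exact ((differentiable_const _).add (differentiable_id.smul_const w)).add (h1.smul_const a)
  have hΦ0 : Φ 0 0 = p := by
    simp only [Φ, ha, smul_smul]
    rw [mul_assoc, ← Complex.exp_add]
    simp
  have hin : ∀ t ∈ Icc (0 : ℝ) 1, ∀ τ : ℂ, ‖τ‖ ≤ s → 0 < t → Φ t τ ∈ Ω := fun t ht τ hτ h => by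
    refine Metric.ball_infDist_compl_subset (x := z₀ + τ • w) ?_
    rw [mem_ball_iff_norm, add_sub_cancel_left, norm_smul, ha1, mul_one, norm_mul, hnexp,
      Complex.norm_real, Real.norm_of_nonneg (by linarith [ht.2])]
    refine lt_of_lt_of_le ?_ (hδ τ hτ)
    have h1 := Real.exp_pos (-(g τ).re)
    have h2 : 0 ≤ Real.exp (-(g τ).re) * (ε * ‖τ‖ ^ 2) := by positivity
    nlinarith
  obtain ⟨m, hm, hmτ⟩ : ∃ m : ℝ, 0 < m ∧ ∀ τ : ℂ, ‖τ‖ ≤ s → m ≤ Real.exp (-(g τ).re) := by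
    have hc : Continuous fun τ => Real.exp (-(g τ).re) :=
      Real.continuous_exp.comp (Complex.continuous_re.comp hg.continuous).neg
    obtain ⟨τ₀, -, h⟩ := (isCompact_closedBall (0 : ℂ) s).exists_isMinOn ⟨0, by simpa using hs.le⟩
      hc.continuousOn
    rw [isMinOn_iff] at h
    exact ⟨_, Real.exp_pos _, fun τ hτ => h τ (by simpa using hτ)⟩
  have hball : ∀ τ : ℂ, ‖τ‖ ≤ s → Metric.ball (Φ 0 τ) (m * ε * ‖τ‖ ^ 2) ⊆ Ω := fun τ hτ x hx => by
    refine Metric.ball_infDist_compl_subset (x := z₀ + τ • w) ?_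
    rw [mem_ball_iff_norm] at hx ⊢
    have h1 : x - (z₀ + τ • w) = (x - Φ 0 τ) + Complex.exp (-g τ) • a := by
      simp only [Φ]
      rw [sub_zero, Complex.ofReal_one, one_mul]
      abel
    rw [h1]
    refine (norm_add_le _ _).trans_lt (lt_of_lt_of_le ?_ (hδ τ hτ))
    rw [norm_smul, hnexp, ha1]
    have := hmτ τ hτ
    have h2 : m * (ε * ‖τ‖ ^ 2) ≤ Real.exp (-(g τ).re) * (ε * ‖τ‖ ^ 2) := by gcongr
    linarith
  refine ⟨Φ, m * ε, s, hΦ, hΦd, by positivity, hs, ?_, fun t ht τ hτ h => ?_, hball⟩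
  · rw [hΩ.frontier_eq, hΦ0]
    refine ⟨mem_closure_of_tendsto (f := fun t : ℝ => Φ t 0) (b := 𝓝[>] 0) ?_ ?_, hp⟩
    · rw [← hΦ0]
      exact ((hΦ.comp (continuous_id.prodMk continuous_const)).tendsto 0).mono_left
        nhdsWithin_le_nhds
    · filter_upwards [Ioo_mem_nhdsGT (zero_lt_one' ℝ)] with t ht
      exact hin t ⟨ht.1.le, ht.2.le⟩ 0 (by simpa using hs.le) ht.1
  · rcases ht.1.eq_or_lt with rfl | ht0
    · have hτ0 := h.resolve_left (lt_irrefl _)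
      have := norm_pos_iff.2 hτ0
      exact hball τ hτ (Metric.mem_ball_self (by positivity))
    · exact hin t ht τ hτ ht0

theorem ContinuousPlurisubharmonicOn.max {u v : EuclideanSpace ℂ (Fin n) → ℝ}
    (hu : ContinuousPlurisubharmonicOn u Ω) (hv : ContinuousPlurisubharmonicOn v Ω) :
    ContinuousPlurisubharmonicOn (fun z => max (u z) (v z)) Ω := by
  have hc : ContinuousOn (fun z => Max.max (u z) (v z)) Ω := ContinuousOn.sup hu.1 hv.1
  refine ⟨hc, fun z w hzw => max_le ((hu.2 z w hzw).trans ?_) ((hv.2 z w hzw).trans ?_)⟩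
  · exact Real.circleAverage_mono (circleIntegrable_affine_of_continuousOn hu.1 hzw)
      (circleIntegrable_affine_of_continuousOn hc hzw) fun ζ _ => le_max_left _ _
  · exact Real.circleAverage_mono (circleIntegrable_affine_of_continuousOn hv.1 hzw)
      (circleIntegrable_affine_of_continuousOn hc hzw) fun ζ _ => le_max_right _ _

theorem continuousPlurisubharmonicOn_norm_sq :
    ContinuousPlurisubharmonicOn (fun z : EuclideanSpace ℂ (Fin n) => ‖z‖ ^ 2) Ω := by
  refine ⟨by fun_prop, fun z w _ => ?_⟩
  have hH : Differentiable ℂ fun ζ : ℂ => ((‖z‖ ^ 2 : ℝ) : ℂ) + 2 * inner ℂ z (ζ • w) := by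
    have : Differentiable ℂ fun ζ : ℂ => inner ℂ z (ζ • w) :=
      (innerSL ℂ z).differentiable.comp (differentiable_id.smul_const w)
    fun_prop
  have h := circleAverage_re_of_entire hH
  simp only [zero_smul, inner_zero_right, mul_zero, add_zero, Complex.ofReal_re] at h
  refine h.symm.le.trans ?_
  refine Real.circleAverage_mono
    ((Complex.continuous_re.comp hH.continuous).continuousOn.circleIntegrable')
    (ContinuousOn.circleIntegrable' (by fun_prop)) fun ζ _ => ?_
  beta_reduce
  rw [norm_add_sq (𝕜 := ℂ), Complex.add_re, Complex.ofReal_re, Complex.mul_re]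
  simp only [RCLike.re_to_complex, Complex.re_ofNat, Complex.im_ofNat, zero_mul, sub_zero]
  have : 0 ≤ ‖ζ • w‖ ^ 2 := by positivity
  linarith

/-- The maximum of `-log δ` and ‖z‖² is an exhaustion: a bound on the first keeps z away from the
complement, a bound on the second keeps it bounded. With empty complement ‖z‖² suffices. -/
theorem isPseudoconvex_of_neg_log_infDist_compl (hΩ : IsOpen Ω)
    (h : Ωᶜ.Nonempty → ContinuousPlurisubharmonicOn
      (fun z => -Real.log (Metric.infDist z Ωᶜ)) Ω) : IsPseudoconvex Ω := by
  refine ⟨hΩ, ?_⟩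
  rcases Ωᶜ.eq_empty_or_nonempty with he | hne
  · rw [compl_empty_iff] at he
    refine ⟨_, continuousPlurisubharmonicOn_norm_sq, fun c => ?_⟩
    refine Metric.isCompact_of_isClosed_isBounded ?_ ?_
    · simp only [he, mem_univ, true_and]
      exact isClosed_le (by fun_prop) continuous_const
    · refine (Metric.isBounded_closedBall (x := 0) (r := √c)).subset fun z hz => ?_
      rw [mem_closedBall_zero_iff]
      exact Real.le_sqrt_of_sq_le hz.2
  · refine ⟨_, (h hne).max continuousPlurisubharmonicOn_norm_sq, fun c => ?_⟩
    have : {z | z ∈ Ω ∧ max (-Real.log (Metric.infDist z Ωᶜ)) (‖z‖ ^ 2) ≤ c}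
        = {z | Real.exp (-c) ≤ Metric.infDist z Ωᶜ ∧ ‖z‖ ^ 2 ≤ c} := by
      ext z
      simp only [mem_ofPred_eq, max_le_iff]
      have hmem : z ∈ Ω ↔ 0 < Metric.infDist z Ωᶜ := by
        rw [← hΩ.isClosed_compl.notMem_iff_infDist_pos hne, notMem_compl_iff]
      constructor
      · rintro ⟨h1, h2, h3⟩
        refine ⟨?_, h3⟩
        rw [← Real.le_log_iff_exp_le (hmem.1 h1)]
        linarith
      · rintro ⟨h1, h3⟩
        have h2 := (Real.exp_pos _).trans_le h1
        refine ⟨hmem.2 h2, ?_, h3⟩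
        rw [← Real.le_log_iff_exp_le h2] at h1
        linarith
    rw [this]
    refine Metric.isCompact_of_isClosed_isBounded ?_ ?_
    · exact (isClosed_le continuous_const (Metric.continuous_infDist_pt _)).inter
        (isClosed_le (continuous_norm.pow 2) continuous_const)
    · refine (Metric.isBounded_closedBall (x := 0) (r := √c)).subset fun z hz => ?_
      rw [mem_closedBall_zero_iff]
      exact Real.le_sqrt_of_sq_le hz.2

end

/-! ### Second order calculus for C² functions. -/

section

variable {E : Type*} [NormedAddCommGroup E] [NormedSpace ℝ E] {ρ : E → ℝ} {p : E}

/-- Second order Taylor expansion of a `C²` function on a real normed space. -/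
theorem ContDiffAt.eventually_abs_sub_taylor_two_le (hρ : ContDiffAt ℝ 2 ρ p) {ε : ℝ} (hε : 0 < ε) :
    ∀ᶠ h in 𝓝 (0 : E),
      |ρ (p + h) - ρ p - fderiv ℝ ρ p h - (1 / 2) * fderiv ℝ (fderiv ℝ ρ) p h h|
        ≤ ε * ‖h‖ ^ 2 := by
  set Q := fderiv ℝ (fderiv ℝ ρ) p with hQ
  have hsymm : ∀ x y, Q x y = Q y x := (hρ.isSymmSndFDerivAt (by simp))
  have hd2 : HasFDerivAt (fderiv ℝ ρ) Q p :=
    ((hρ.fderiv_right (m := 1) (by norm_num)).differentiableAt (by norm_num)).hasFDerivAt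
  have hd1 : ∀ᶠ z in 𝓝 p, DifferentiableAt ℝ ρ z :=
    (hρ.eventually (by simp)).mono fun z hz => hz.differentiableAt (by norm_num)
  have ht : Filter.Tendsto (fun h : E => p + h) (𝓝 0) (𝓝 p) := by
    have : Continuous fun h : E => p + h := by fun_prop
    simpa using this.tendsto 0
  have hlo := (hasFDerivAt_iff_isLittleO_nhds_zero.1 hd2).def hε
  obtain ⟨r, hr, hball⟩ := Metric.eventually_nhds_iff_ball.1 (hlo.and (ht.eventually hd1))
  filter_upwards [Metric.ball_mem_nhds (0 : E) hr] with h hh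
  rw [mem_ball_zero_iff] at hh
  -- By symmetry of Q the derivative of f is the first order remainder of `fderiv ℝ ρ`, at most ε‖h‖
  -- on the ball of radius ‖h‖; the mean value inequality supplies the second factor ‖h‖.
  let f : E → ℝ := fun x => ρ (p + x) - fderiv ℝ ρ p x - (1 / 2) * Q x x
  have hf : ∀ x ∈ Metric.closedBall (0 : E) ‖h‖,
      HasFDerivWithinAt f (fderiv ℝ ρ (p + x) - fderiv ℝ ρ p - Q x)
        (Metric.closedBall (0 : E) ‖h‖) x := fun x hx => by
    have hxr : x ∈ Metric.ball (0 : E) r := Metric.closedBall_subset_ball hh hx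
    have h1 : HasFDerivAt (fun x => ρ (p + x)) (fderiv ℝ ρ (p + x)) x := by
      exact ((hball x hxr).2.hasFDerivAt.comp x ((hasFDerivAt_id x).const_add p)).congr_fderiv
        (ContinuousLinearMap.comp_id _)
    have h2 : HasFDerivAt (fun x => Q x x) ((Q x) + (Q.flip x)) x := by
      have := Q.hasFDerivAt_of_bilinear (hasFDerivAt_id x) (hasFDerivAt_id x)
      refine this.congr_fderiv ?_
      ext y
      simp
    have h3 := (h1.sub (fderiv ℝ ρ p).hasFDerivAt).sub (h2.const_mul (1 / 2 : ℝ))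
    refine (h3.congr_fderiv ?_).hasFDerivWithinAt
    ext y
    simp [hsymm y x]
    ring
  have hb : ∀ x ∈ Metric.closedBall (0 : E) ‖h‖,
      ‖fderiv ℝ ρ (p + x) - fderiv ℝ ρ p - Q x‖ ≤ ε * ‖h‖ := fun x hx => by
    refine (hball x (Metric.closedBall_subset_ball hh hx)).1.trans ?_
    rw [mem_closedBall_zero_iff] at hx
    gcongr
  have := (convex_closedBall (0 : E) ‖h‖).norm_image_sub_le_of_norm_hasFDerivWithin_le hf hb
    (x := 0) (y := h) (by simp) (by simp)
  simp only [f, add_zero, map_zero, sub_zero, mul_zero, Real.norm_eq_abs] at this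
  rw [pow_two, ← mul_assoc]
  convert this using 2
  ring

/-- First and second order necessary conditions along a curve on which a `C²` function vanishing at
`p` is bounded above by `-c t²`. -/
theorem ContDiffAt.second_order_condition (hρ : ContDiffAt ℝ 2 ρ p) (hp : ρ p = 0) {x : E}
    {κ : ℝ → E} (hκ : ContinuousAt κ 0) {c : ℝ}
    (hle : ∀ᶠ t in 𝓝[>] (0 : ℝ), ρ (p + t • (x + t • κ t)) ≤ -c * t ^ 2) :
    fderiv ℝ ρ p x ≤ 0 ∧ (fderiv ℝ ρ p x = 0 →
      fderiv ℝ ρ p (κ 0) + (1 / 2) * fderiv ℝ (fderiv ℝ ρ) p x x ≤ -c) := by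
  set ℓ := fderiv ℝ ρ p
  set Q := fderiv ℝ (fderiv ℝ ρ) p
  have hy : ContinuousAt (fun t : ℝ => x + t • κ t) 0 := by fun_prop
  have hy0 : ContinuousAt (fun t : ℝ => t • (x + t • κ t)) 0 := by fun_prop
  -- Dividing by t gives the first order condition. If ℓ x = 0, then tℓ(x + tκ) = t²ℓ(κ), and
  -- dividing by t² gives the second.
  have hexp : ∀ ε > 0, ∀ᶠ t in 𝓝[>] (0 : ℝ), 0 < t ∧
      t * ℓ (x + t • κ t) + t ^ 2 * ((1 / 2) * Q (x + t • κ t) (x + t • κ t))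
        ≤ -c * t ^ 2 + ε * (t ^ 2 * ‖x + t • κ t‖ ^ 2) := fun ε hε => by
    have h1 : Filter.Tendsto (fun t : ℝ => t • (x + t • κ t)) (𝓝[>] 0) (𝓝 0) := by
      have := hy0.tendsto
      simp only [zero_smul] at this
      exact this.mono_left nhdsWithin_le_nhds
    filter_upwards [h1.eventually (hρ.eventually_abs_sub_taylor_two_le hε), hle,
      self_mem_nhdsWithin] with t ht1 ht2 ht3
    have h2 := (abs_le.1 ht1).1
    refine ⟨ht3, ?_⟩
    rw [norm_smul, mul_pow, Real.norm_eq_abs, sq_abs, hp, map_smul, map_smul,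
      map_smul, smul_apply, smul_eq_mul, smul_eq_mul, smul_eq_mul] at h2
    linarith
  have hcont : ∀ ε : ℝ, ContinuousAt (fun t : ℝ => ε * ‖x + t • κ t‖ ^ 2
      - (1 / 2) * Q (x + t • κ t) (x + t • κ t)) 0 := fun ε => by fun_prop
  refine ⟨?_, fun h0 => ?_⟩
  · have h1 : Filter.Tendsto (fun t : ℝ => ℓ (x + t • κ t)) (𝓝[>] 0) (𝓝 (ℓ x)) := by
      have : ContinuousAt (fun t : ℝ => ℓ (x + t • κ t)) 0 := by fun_prop
      simpa using this.tendsto.mono_left nhdsWithin_le_nhds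
    have h2 : Filter.Tendsto (fun t : ℝ => t * (-c + (1 * ‖x + t • κ t‖ ^ 2
      - (1 / 2) * Q (x + t • κ t) (x + t • κ t)))) (𝓝[>] 0) (𝓝 0) := by
      have : ContinuousAt (fun t : ℝ => t * (-c + (1 * ‖x + t • κ t‖ ^ 2
        - (1 / 2) * Q (x + t • κ t) (x + t • κ t)))) 0 :=
        continuousAt_id.mul (continuousAt_const.add (hcont 1))
      simpa using this.tendsto.mono_left nhdsWithin_le_nhds
    refine le_of_tendsto_of_tendsto h1 h2 ?_
    filter_upwards [hexp 1 one_pos] with t ht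
    refine le_of_mul_le_mul_left ?_ ht.1
    linarith [ht.2]
  · refine le_of_forall_pos_le_add fun δ hδ => ?_
    set ε := δ / (‖x‖ ^ 2 + 1) with hε
    have hε0 : 0 < ε := by positivity
    have h1 : Filter.Tendsto (fun t : ℝ => ℓ (κ t)) (𝓝[>] 0) (𝓝 (ℓ (κ 0))) := by
      have : ContinuousAt (fun t : ℝ => ℓ (κ t)) 0 := by fun_prop
      exact this.tendsto.mono_left nhdsWithin_le_nhds
    have h2 : Filter.Tendsto (fun t : ℝ => -c + (ε * ‖x + t • κ t‖ ^ 2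
        - (1 / 2) * Q (x + t • κ t) (x + t • κ t))) (𝓝[>] 0)
        (𝓝 (-c + (ε * ‖x‖ ^ 2 - (1 / 2) * Q x x))) := by
      have := (hcont ε).tendsto.mono_left (nhdsWithin_le_nhds (s := Ioi 0))
      rw [zero_smul, add_zero] at this
      exact this.const_add (-c)
    have h3 := le_of_tendsto_of_tendsto h1 h2 (by
      filter_upwards [hexp ε hε0] with t ht
      have h4 := ht.2
      rw [map_add, h0, zero_add, map_smul, smul_eq_mul] at h4
      have h5 : 0 < t ^ 2 := by have := ht.1; positivity
      refine le_of_mul_le_mul_left ?_ h5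
      linarith)
    have h4 : ε * ‖x‖ ^ 2 ≤ δ := by
      rw [hε, div_mul_eq_mul_div, div_le_iff₀ (by positivity)]
      nlinarith
    linarith

end

/-! ### The Levi form and quadratic discs. -/

section

variable {n : ℕ} {ρ : EuclideanSpace ℂ (Fin n) → ℝ} {p : EuclideanSpace ℂ (Fin n)}

theorem smul_eq_re_smul_add_im_smul_I (τ : ℂ) (v : EuclideanSpace ℂ (Fin n)) :
    τ • v = τ.re • v + τ.im • (Complex.I • v) := by
  rw [← Complex.coe_smul, ← Complex.coe_smul, smul_smul, ← add_smul, Complex.re_add_im]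

/-- The complex linear form with real part `ℓ`. -/
noncomputable def complexForm (ℓ : EuclideanSpace ℂ (Fin n) →L[ℝ] ℝ)
    (x : EuclideanSpace ℂ (Fin n)) : ℂ :=
  ⟨ℓ x, -ℓ (Complex.I • x)⟩

theorem complexForm_smul (ℓ : EuclideanSpace ℂ (Fin n) →L[ℝ] ℝ) (τ : ℂ)
    (x : EuclideanSpace ℂ (Fin n)) : complexForm ℓ (τ • x) = τ * complexForm ℓ x := by
  have h : Complex.I • τ • x = (-τ.im) • x + τ.re • (Complex.I • x) := by
    rw [smul_smul, smul_eq_re_smul_add_im_smul_I]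
    simp
  apply Complex.ext
  · simp only [complexForm, Complex.mul_re]
    rw [smul_eq_re_smul_add_im_smul_I, map_add, map_smul, map_smul, smul_eq_mul, smul_eq_mul]
    ring
  · simp only [complexForm, Complex.mul_im]
    rw [h, map_add, map_smul, map_smul, smul_eq_mul, smul_eq_mul]
    ring

theorem complexForm_sub (ℓ : EuclideanSpace ℂ (Fin n) →L[ℝ] ℝ)
    (x y : EuclideanSpace ℂ (Fin n)) :
    complexForm ℓ (x - y) = complexForm ℓ x - complexForm ℓ y := by
  apply Complex.ext
  · simp [complexForm]
  · simp only [complexForm, smul_sub, map_sub, Complex.sub_im]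
    ring

/-- If the Levi form of `ρ` at a zero `p` is negative in a complex tangential direction `v`, then a
quadratic disc tangent to `v` touches `{ρ ≥ 0}` at `p` to second order. -/
theorem exists_quadratic_disc_of_levi_neg (hρ : ContDiffAt ℝ 2 ρ p) (hp : ρ p = 0)
    {v ν : EuclideanSpace ℂ (Fin n)} (hν : 0 < fderiv ℝ ρ p ν)
    (hv : complexForm (fderiv ℝ ρ p) v = 0)
    (hlevi : fderiv ℝ (fderiv ℝ ρ) p v v
      + fderiv ℝ (fderiv ℝ ρ) p (Complex.I • v) (Complex.I • v) < 0) :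
    ∃ (b : EuclideanSpace ℂ (Fin n)) (c : ℝ), 0 < c ∧
      ∀ᶠ τ in 𝓝 (0 : ℂ), ρ (p + (τ • v + τ ^ 2 • b)) ≤ -c * ‖τ‖ ^ 2 := by
  set ℓ := fderiv ℝ ρ p with hℓ
  set Q := fderiv ℝ (fderiv ℝ ρ) p with hQ
  have hsymm : ∀ x y, Q x y = Q y x := (hρ.isSymmSndFDerivAt (by simp))
  set A := Q v v
  set C := Q (Complex.I • v) (Complex.I • v)
  set B := Q v (Complex.I • v) with hB
  have hν0 : complexForm ℓ ν ≠ 0 := fun h => hν.ne' (congrArg Complex.re h)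
  -- With this β, Re(βτ²) cancels the harmonic part of ½Q(τv, τv), leaving ¼(A + C)|τ|² = -λ|τ|². A
  -- complex multiple of ν realises β because the complex form does not vanish on ν.
  set β : ℂ := ⟨-(A - C) / 4, B / 2⟩ with hβ
  set b := (β / complexForm ℓ ν) • ν with hb
  have hℓb : complexForm ℓ b = β := by
    rw [hb, complexForm_smul, div_mul_cancel₀ _ hν0]
  set lam := -(A + C) / 4 with hlam
  have hlam0 : 0 < lam := by rw [hlam]; linarith
  set N := ‖v‖ + ‖b‖
  -- The Taylor remainder and the terms of Q involving b each cost at most λ/4 · |τ|², leaving λ/2.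
  set ε := lam / (4 * (N ^ 2 + 1)) with hε
  have hε0 : 0 < ε := by positivity
  have hεN : ε * N ^ 2 ≤ lam / 4 := by
    rw [hε, div_mul_eq_mul_div, div_le_div_iff₀ (by positivity) (by positivity)]
    nlinarith
  set K := (1 / 2) * (‖Q‖ * (2 * ‖v‖ * ‖b‖ + ‖b‖ ^ 2)) with hK
  have hK0 : 0 ≤ K := by positivity
  have hev1 : ∀ᶠ τ in 𝓝 (0 : ℂ), |ρ (p + (τ • v + τ ^ 2 • b)) - ρ p - ℓ (τ • v + τ ^ 2 • b)
      - (1 / 2) * Q (τ • v + τ ^ 2 • b) (τ • v + τ ^ 2 • b)| ≤ ε * ‖τ • v + τ ^ 2 • b‖ ^ 2 := by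
    have hc : Continuous fun τ : ℂ => τ • v + τ ^ 2 • b := by fun_prop
    have ht := hc.tendsto 0
    simp only [zero_smul, add_zero, ne_eq, OfNat.ofNat_ne_zero, not_false_eq_true, zero_pow] at ht
    exact ht.eventually (hρ.eventually_abs_sub_taylor_two_le hε0)
  have hev2 : ∀ᶠ τ in 𝓝 (0 : ℂ), K * ‖τ‖ < lam / 4 :=
    (by fun_prop : Continuous fun τ : ℂ => K * ‖τ‖).continuousAt.eventually_lt_const
      (by simp; linarith)
  have hev3 : ∀ᶠ τ in 𝓝 (0 : ℂ), ‖τ‖ < 1 :=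
    continuous_norm.continuousAt.eventually_lt_const (by simp)
  refine ⟨b, lam / 2, by positivity, ?_⟩
  filter_upwards [hev1, hev2, hev3] with τ h1 h2 h3
  have hτ0 := norm_nonneg τ
  have hℓh : ℓ (τ • v + τ ^ 2 • b) = (τ.re ^ 2 - τ.im ^ 2) * β.re - 2 * τ.re * τ.im * β.im := by
    have e1 : ℓ (τ • v) = 0 := by
      have := congrArg Complex.re (complexForm_smul ℓ τ v)
      rw [hv, mul_zero] at this
      exact this
    have e2 := congrArg Complex.re (complexForm_smul ℓ (τ ^ 2) b)
    rw [hℓb, pow_two, Complex.mul_re, Complex.mul_re, Complex.mul_im] at e2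
    rw [map_add, e1, zero_add, pow_two]
    refine Eq.trans e2 ?_
    ring
  have hQv : Q (τ • v) (τ • v) = τ.re ^ 2 * A + 2 * τ.re * τ.im * B + τ.im ^ 2 * C := by
    rw [smul_eq_re_smul_add_im_smul_I]
    simp only [map_add, map_smul, add_apply, smul_apply,
      smul_eq_mul]
    rw [hsymm (Complex.I • v) v]
    ring
  have hnorm2 : ‖τ‖ ^ 2 = τ.re ^ 2 + τ.im ^ 2 := by
    rw [Complex.sq_norm, Complex.normSq_apply]; ring
  have hQh : (1 / 2) * Q (τ • v + τ ^ 2 • b) (τ • v + τ ^ 2 • b)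
      ≤ (1 / 2) * Q (τ • v) (τ • v) + K * ‖τ‖ * ‖τ‖ ^ 2 := by
    have e1 := (le_abs_self _).trans (Q.le_opNorm₂ (τ • v) (τ ^ 2 • b))
    have e2 := (le_abs_self _).trans (Q.le_opNorm₂ (τ ^ 2 • b) (τ ^ 2 • b))
    rw [norm_smul, norm_smul, norm_pow] at e1
    rw [norm_smul, norm_pow] at e2
    have e3 : ‖Q‖ * (‖τ‖ ^ 2 * ‖b‖) * (‖τ‖ ^ 2 * ‖b‖) ≤ ‖Q‖ * ‖b‖ ^ 2 * ‖τ‖ ^ 3 := by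
      calc ‖Q‖ * (‖τ‖ ^ 2 * ‖b‖) * (‖τ‖ ^ 2 * ‖b‖)
          = ‖Q‖ * ‖b‖ ^ 2 * ‖τ‖ ^ 3 * ‖τ‖ := by ring
        _ ≤ ‖Q‖ * ‖b‖ ^ 2 * ‖τ‖ ^ 3 * 1 := by gcongr
        _ = _ := mul_one _
    simp only [map_add, add_apply]
    rw [hsymm (τ ^ 2 • b) (τ • v), hK]
    linarith
  have hhn : ‖τ • v + τ ^ 2 • b‖ ^ 2 ≤ N ^ 2 * ‖τ‖ ^ 2 := by
    rw [← mul_pow]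
    gcongr
    calc ‖τ • v + τ ^ 2 • b‖ ≤ ‖τ‖ * ‖v‖ + ‖τ‖ ^ 2 * ‖b‖ := by
          refine (norm_add_le _ _).trans ?_
          rw [norm_smul, norm_smul, norm_pow]
      _ ≤ ‖τ‖ * ‖v‖ + ‖τ‖ * ‖b‖ := by
          gcongr
          rw [pow_two]
          exact mul_le_of_le_one_left hτ0 h3.le
      _ = N * ‖τ‖ := by ring
  have h4 := (abs_le.1 h1).2
  have h5 : ε * ‖τ • v + τ ^ 2 • b‖ ^ 2 ≤ lam / 4 * ‖τ‖ ^ 2 := by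
    calc ε * ‖τ • v + τ ^ 2 • b‖ ^ 2 ≤ ε * (N ^ 2 * ‖τ‖ ^ 2) := by gcongr
      _ = ε * N ^ 2 * ‖τ‖ ^ 2 := by ring
      _ ≤ _ := by gcongr
  have h6 : K * ‖τ‖ * ‖τ‖ ^ 2 ≤ lam / 4 * ‖τ‖ ^ 2 := by gcongr
  have h7 : ℓ (τ • v + τ ^ 2 • b) + (1 / 2) * Q (τ • v) (τ • v) = -lam * ‖τ‖ ^ 2 := by
    rw [hℓh, hQv, hnorm2, hβ, hlam]
    simp only
    ring
  rw [hp] at h4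
  linarith

end

theorem add_le_of_le_fderiv_apply {E : Type*} [NormedAddCommGroup E] [NormedSpace ℝ E] {ρ : E → ℝ}
    {s : Set E} (hs : Convex ℝ s) (hρ : ∀ z ∈ s, DifferentiableAt ℝ ρ z) {ν : E} {m : ℝ}
    (hm : ∀ z ∈ s, m ≤ fderiv ℝ ρ z ν) {z : E} (hz : z ∈ s) {t : ℝ} (ht : 0 ≤ t)
    (hzt : z + t • ν ∈ s) : ρ z + m * t ≤ ρ (z + t • ν) := by
  have hmem : ∀ r ∈ Icc 0 t, z + r • ν ∈ s := fun r hr => by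
    rcases ht.eq_or_lt with rfl | ht0
    · obtain rfl : r = 0 := le_antisymm hr.2 hr.1
      exact hzt
    · have := hs.add_smul_sub_mem hz hzt (t := r / t)
        ⟨div_nonneg hr.1 ht, (div_le_one ht0).2 hr.2⟩
      rwa [add_sub_cancel_left, smul_smul, div_mul_cancel₀ _ ht0.ne'] at this
  have hd : ∀ r ∈ Icc 0 t, HasDerivAt (fun r : ℝ => ρ (z + r • ν)) (fderiv ℝ ρ (z + r • ν) ν) r :=
    fun r hr => by
      have h1 : HasDerivAt (fun r : ℝ => z + r • ν) ν r := by
        simpa using ((hasDerivAt_id r).smul_const ν).const_add z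
      exact (hρ _ (hmem r hr)).hasFDerivAt.comp_hasDerivAt r h1
  have h := (convex_Icc 0 t).mul_sub_le_image_sub_of_le_deriv (f := fun r : ℝ => ρ (z + r • ν))
    (C := m) (fun r hr => (hd r hr).continuousAt.continuousWithinAt)
    (fun r hr => (hd r (interior_subset hr)).differentiableAt.differentiableWithinAt)
    (fun r hr => by
      rw [(hd r (interior_subset hr)).deriv]
      exact hm _ (hmem r (interior_subset hr)))
    0 (left_mem_Icc.2 ht) t (right_mem_Icc.2 ht) ht
  simp only [zero_smul, add_zero, sub_zero] at h
  linarith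

/-! ### Discs touching a C² boundary. -/

section

variable {n : ℕ} {Ω : Set (EuclideanSpace ℂ (Fin n))} {p : EuclideanSpace ℂ (Fin n)}

theorem eq_zero_of_mem_frontier_of_defining {U : Set (EuclideanSpace ℂ (Fin n))}
    {ρ : EuclideanSpace ℂ (Fin n) → ℝ} (hΩ : IsOpen Ω) (hU : IsOpen U) (hρ : ContinuousOn ρ U)
    (hΩU : Ω ∩ U = {z | z ∈ U ∧ ρ z < 0}) (hp : p ∈ frontier Ω) (hpU : p ∈ U) : ρ p = 0 := by
  rw [hΩ.frontier_eq] at hp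
  refine le_antisymm ?_ ?_
  · by_contra! h
    obtain ⟨z, ⟨hz1, hz2⟩, hz3⟩ := mem_closure_iff_nhds.1 hp.1 _
      (Filter.inter_mem ((hρ.continuousAt (hU.mem_nhds hpU)).eventually_const_lt h)
        (hU.mem_nhds hpU))
    have hz : z ∈ Ω ∩ U := ⟨hz3, hz2⟩
    rw [hΩU] at hz
    exact lt_asymm hz.2 hz1
  · by_contra! h
    have : p ∈ Ω ∩ U := by rw [hΩU]; exact ⟨hpU, h⟩
    exact hp.2 this.1

/-- An entire disc contained in `Ω` to second order which touches the `C²` boundary of `Ω` at `p`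
has a complex tangential velocity at which the Levi form of a defining function is negative. -/
theorem levi_neg_of_disc {ρ : EuclideanSpace ℂ (Fin n) → ℝ} (hρ : ContDiffAt ℝ 2 ρ p)
    (hp : ρ p = 0) {φ : ℂ → EuclideanSpace ℂ (Fin n)} (hφ : Differentiable ℂ φ) (hφp : φ 0 = p)
    {c : ℝ} (hc : 0 < c) (hle : ∀ᶠ τ in 𝓝 (0 : ℂ), ρ (φ τ) ≤ -c * ‖τ‖ ^ 2) :
    complexForm (fderiv ℝ ρ p) (deriv φ 0) = 0 ∧
      fderiv ℝ (fderiv ℝ ρ) p (deriv φ 0) (deriv φ 0)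
        + fderiv ℝ (fderiv ℝ ρ) p (Complex.I • deriv φ 0) (Complex.I • deriv φ 0) < 0 := by
  obtain ⟨ψ, hψ, hexp⟩ := exists_entire_quadratic_expansion hφ 0
  set v := deriv φ 0
  have key : ∀ η : ℂ, ‖η‖ = 1 → fderiv ℝ ρ p (η • v) ≤ 0 ∧ (fderiv ℝ ρ p (η • v) = 0 →
      fderiv ℝ ρ p (η ^ 2 • ψ 0) + (1 / 2) * fderiv ℝ (fderiv ℝ ρ) p (η • v) (η • v) ≤ -c) := by
    intro η hη
    have hκ : Continuous fun t : ℝ => η ^ 2 • ψ (t * η) := by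
      have := hψ.continuous
      fun_prop
    have h := hρ.second_order_condition hp (x := η • v) hκ.continuousAt (c := c) (by
      have ht : Filter.Tendsto (fun t : ℝ => (t : ℂ) * η) (𝓝[>] 0) (𝓝 0) := by
        have : Continuous fun t : ℝ => (t : ℂ) * η := by fun_prop
        simpa using (this.tendsto 0).mono_left nhdsWithin_le_nhds
      filter_upwards [ht.eventually hle] with t ht
      rw [norm_mul, hη, mul_one, Complex.norm_real, Real.norm_eq_abs, sq_abs] at ht
      refine le_trans (le_of_eq ?_) ht
      have e := hexp (t * η)
      rw [zero_add, hφp] at e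
      rw [e, add_assoc, smul_add, ← Complex.coe_smul, ← Complex.coe_smul, ← Complex.coe_smul]
      simp only [smul_smul]
      congr 4
      ring)
    simpa using h
  -- Opposite directions force the first derivative to vanish on v and iv. Adding the second order
  -- conditions for η = 1 and η = i cancels the terms in ψ(0), since η² = ±1, and leaves half the
  -- Levi form ≤ -2c.
  have h1 := key 1 (by simp)
  have h2 := key (-1) (by simp)
  have h3 := key Complex.I (by simp)
  have h4 := key (-Complex.I) (by simp)
  simp only [one_smul, neg_smul, map_neg, one_pow, Complex.I_sq] at h1 h2 h3 h4
  have e1 : fderiv ℝ ρ p v = 0 := le_antisymm h1.1 (by linarith [h2.1])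
  have e2 : fderiv ℝ ρ p (Complex.I • v) = 0 := le_antisymm h3.1 (by linarith [h4.1])
  refine ⟨?_, ?_⟩
  · apply Complex.ext
    · exact e1
    · simp [complexForm, e2]
  · have := h1.2 e1
    have := h3.2 e2
    linarith

/-- Negativity of the Levi form at a boundary point persists at nearby points. -/
theorem eventually_exists_levi_neg {ρ : EuclideanSpace ℂ (Fin n) → ℝ} (hρ : ContDiffAt ℝ 2 ρ p)
    {v ν : EuclideanSpace ℂ (Fin n)} (hν : 0 < fderiv ℝ ρ p ν)
    (hv : complexForm (fderiv ℝ ρ p) v = 0)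
    (hlevi : fderiv ℝ (fderiv ℝ ρ) p v v
      + fderiv ℝ (fderiv ℝ ρ) p (Complex.I • v) (Complex.I • v) < 0) :
    ∀ᶠ q in 𝓝 p, 0 < fderiv ℝ ρ q ν ∧ ∃ v', complexForm (fderiv ℝ ρ q) v' = 0 ∧
      fderiv ℝ (fderiv ℝ ρ) q v' v'
        + fderiv ℝ (fderiv ℝ ρ) q (Complex.I • v') (Complex.I • v') < 0 := by
  have hd : ContDiffAt ℝ 1 (fderiv ℝ ρ) p := hρ.fderiv_right (m := 1) (by norm_num)
  have hd1 : ContinuousAt (fderiv ℝ ρ) p := hd.continuousAt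
  have hd2 : ContinuousAt (fderiv ℝ (fderiv ℝ ρ)) p :=
    (hd.fderiv_right (m := 0) (by norm_num)).continuousAt
  have hcf : ∀ x, ContinuousAt (fun q => complexForm (fderiv ℝ ρ q) x) p := fun x => by
    have : (fun q => complexForm (fderiv ℝ ρ q) x) = fun q =>
        ((fderiv ℝ ρ q x : ℝ) : ℂ) + ((-fderiv ℝ ρ q (Complex.I • x) : ℝ) : ℂ) * Complex.I := by
      ext q
      rw [← Complex.mk_eq_add_mul_I]
      rfl
    rw [this]
    have h1 : ContinuousAt (fun q => fderiv ℝ ρ q x) p := by fun_prop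
    have h2 : ContinuousAt (fun q => -fderiv ℝ ρ q (Complex.I • x)) p := by fun_prop
    exact (Complex.continuous_ofReal.continuousAt.comp h1).add
      ((Complex.continuous_ofReal.continuousAt.comp h2).mul continuousAt_const)
  have hν0 : complexForm (fderiv ℝ ρ p) ν ≠ 0 := fun h => hν.ne' (congrArg Complex.re h)
  -- Projection of v along ν onto the complex tangent space at q, continuous in q at p.
  let V : EuclideanSpace ℂ (Fin n) → EuclideanSpace ℂ (Fin n) := fun q =>
    v - (complexForm (fderiv ℝ ρ q) v / complexForm (fderiv ℝ ρ q) ν) • ν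
  have hV : ContinuousAt V p :=
    continuousAt_const.sub (((hcf v).div (hcf ν) hν0).smul continuousAt_const)
  have hVp : V p = v := by simp [V, hv]
  have hc : ContinuousAt (fun q => fderiv ℝ (fderiv ℝ ρ) q (V q) (V q)
      + fderiv ℝ (fderiv ℝ ρ) q (Complex.I • V q) (Complex.I • V q)) p := by
    have hI : ContinuousAt (fun q => Complex.I • V q) p :=
      (continuous_const_smul Complex.I).continuousAt.comp hV
    exact ((hd2.clm_apply hV).clm_apply hV).add ((hd2.clm_apply hI).clm_apply hI)
  have hcν : ContinuousAt (fun q => fderiv ℝ ρ q ν) p := by fun_prop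
  filter_upwards [hcν.eventually_const_lt hν, hc.eventually_lt_const (by beta_reduce; rwa [hVp])] with q h1 h2
  refine ⟨h1, V q, ?_, h2⟩
  have h3 : complexForm (fderiv ℝ ρ q) ν ≠ 0 := fun h => h1.ne' (congrArg Complex.re h)
  simp only [V]
  rw [complexForm_sub, complexForm_smul, div_mul_cancel₀ _ h3, sub_self]

/-- If an entire disc in `Ω` touches the `C²` boundary of `Ω` at `p` with quadratic room, then
`Ω` is not locally pseudoconvex at any boundary point close to `p`. -/
theorem HasC2BoundaryNear.eventually_not_locallyPseudoconvexAt (hC2 : HasC2BoundaryNear Ω p)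
    (hΩ : IsOpen Ω) (hp : p ∈ frontier Ω) {φ : ℂ → EuclideanSpace ℂ (Fin n)}
    (hφ : Differentiable ℂ φ) (hφp : φ 0 = p) {c s : ℝ} (hc : 0 < c) (hs : 0 < s)
    (hball : ∀ τ : ℂ, ‖τ‖ ≤ s → Metric.ball (φ τ) (c * ‖τ‖ ^ 2) ⊆ Ω) :
    ∀ᶠ q in 𝓝 p, q ∈ frontier Ω → ¬ LocallyPseudoconvexAt Ω q := by
  obtain ⟨U, ρ, hU, hpU, hρ, hdρ, hΩU⟩ := hC2
  have hρat : ∀ z ∈ U, ContDiffAt ℝ 2 ρ z := fun z hz => hρ.contDiffAt (hU.mem_nhds hz)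
  obtain ⟨ν, hν⟩ : ∃ ν, fderiv ℝ ρ p ν = 1 := by
    obtain ⟨x, hx⟩ : ∃ x, fderiv ℝ ρ p x ≠ 0 := by
      by_contra! h
      exact hdρ p hpU (ContinuousLinearMap.ext h)
    exact ⟨(fderiv ℝ ρ p x)⁻¹ • x, by rw [map_smul, smul_eq_mul, inv_mul_cancel₀ hx]⟩
  have hcν : ContinuousAt (fun q => fderiv ℝ ρ q ν) p := by
    have : ContinuousAt (fderiv ℝ ρ) p :=
      ((hρat p hpU).fderiv_right (m := 1) (by norm_num)).continuousAt
    fun_prop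
  obtain ⟨R, hR, hRb⟩ := Metric.eventually_nhds_iff_ball.1
    ((hcν.eventually_const_lt (u := 1 / 2) (by beta_reduce; rw [hν]; norm_num)).and (hU.mem_nhds hpU))
  have hmono : ∀ z ∈ Metric.ball p R, ∀ t : ℝ, 0 ≤ t → z + t • ν ∈ Metric.ball p R →
      ρ z + 1 / 2 * t ≤ ρ (z + t • ν) := fun z hz t ht hzt =>
    add_le_of_le_fderiv_apply (convex_ball p R)
      (fun z hz => (hρat z (hRb z hz).2).differentiableAt (by norm_num))
      (fun z hz => (hRb z hz).1.le) hz ht hzt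
  have hν0 : 0 < ‖ν‖ := norm_pos_iff.2 fun h => by simp [h] at hν
  -- Moving φ(τ) by k|τ|²ν uses half the available room, so ρ < 0 there when τ ≠ 0; since ρ grows
  -- along ν at rate at least 1/2, ρ(φ(τ)) ≤ -(k/2)|τ|².
  set k := c / (2 * ‖ν‖) with hk
  have hk0 : 0 < k := by positivity
  have hle : ∀ᶠ τ in 𝓝 (0 : ℂ), ρ (φ τ) ≤ -(k / 2) * ‖τ‖ ^ 2 := by
    have h1 : ∀ᶠ τ in 𝓝 (0 : ℂ), φ τ ∈ Metric.ball p R :=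
      hφ.continuous.continuousAt.eventually_mem (by rw [hφp]; exact Metric.ball_mem_nhds p hR)
    have h2 : ∀ᶠ τ in 𝓝 (0 : ℂ), φ τ + (k * ‖τ‖ ^ 2) • ν ∈ Metric.ball p R := by
      have : Continuous fun τ : ℂ => φ τ + (k * ‖τ‖ ^ 2) • ν := by
        have := hφ.continuous
        fun_prop
      exact this.continuousAt.eventually_mem (by simpa [hφp] using Metric.ball_mem_nhds p hR)
    have h3 : ∀ᶠ τ in 𝓝 (0 : ℂ), ‖τ‖ < s :=
      continuous_norm.continuousAt.eventually_lt_const (by simpa using hs)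
    filter_upwards [h1, h2, h3] with τ h1 h2 h3
    have h4 := hmono _ h1 _ (by positivity) h2
    rcases eq_or_ne τ 0 with rfl | hτ
    · rw [hφp, eq_zero_of_mem_frontier_of_defining hΩ hU hρ.continuousOn hΩU hp hpU]
      simp
    · have hτ0 := norm_pos_iff.2 hτ
      have h5 : φ τ + (k * ‖τ‖ ^ 2) • ν ∈ Ω ∩ U := by
        refine ⟨hball τ h3.le ?_, (hRb _ h2).2⟩
        rw [mem_ball_iff_norm, add_sub_cancel_left, norm_smul, Real.norm_of_nonneg (by positivity)]
        have : k * ‖τ‖ ^ 2 * ‖ν‖ = c * ‖τ‖ ^ 2 / 2 := by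
          rw [hk]
          field_simp
        rw [this]
        have : 0 < c * ‖τ‖ ^ 2 := by positivity
        linarith
      rw [hΩU] at h5
      have := h5.2
      linarith
  obtain ⟨hv, hlevi⟩ := levi_neg_of_disc (hρat p hpU)
    (eq_zero_of_mem_frontier_of_defining hΩ hU hρ.continuousOn hΩU hp hpU) hφ hφp
    (half_pos hk0) hle
  filter_upwards [eventually_exists_levi_neg (hρat p hpU) (by rw [hν]; exact one_pos) hv hlevi,
    Metric.ball_mem_nhds p hR] with q ⟨hνq, v', hv', hlevi'⟩ hqR hq hloc
  have hqU := (hRb q hqR).2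
  have hq0 := eq_zero_of_mem_frontier_of_defining hΩ hU hρ.continuousOn hΩU hq hqU
  obtain ⟨b, c', hc', hdisc⟩ := exists_quadratic_disc_of_levi_neg (hρat q hqU) hq0 hνq hv' hlevi'
  -- The quadratic disc at q pushed inwards: ρ(Φ t τ) ≤ -c'|τ|² - t/2 for small t ≥ 0 and small τ.
  let Φ : ℝ → ℂ → EuclideanSpace ℂ (Fin n) := fun t τ => q + (τ • v' + τ ^ 2 • b) - t • ν
  have hΦ : Continuous fun p : ℝ × ℂ => Φ p.1 p.2 := by fun_prop
  have hΦd : ∀ t, Differentiable ℂ (Φ t) := fun t => by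
    have h1 : Differentiable ℂ fun τ : ℂ => τ ^ 2 • b := (differentiable_id.pow 2).smul_const b
    exact (((differentiable_id.smul_const v').add h1).const_add q).sub_const _
  have hΦ0 : Φ 0 0 = q := by simp [Φ]
  have hev : ∀ᶠ x : ℝ × ℂ in 𝓝 0, Φ x.1 x.2 ∈ Metric.ball p R ∧ Φ 0 x.2 ∈ Metric.ball p R ∧
      ρ (q + (x.2 • v' + x.2 ^ 2 • b)) ≤ -c' * ‖x.2‖ ^ 2 := by
    have hqb : Metric.ball p R ∈ 𝓝 q := Metric.isOpen_ball.mem_nhds hqR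
    have h2 : Continuous fun x : ℝ × ℂ => Φ 0 x.2 :=
      hΦ.comp (continuous_const.prodMk continuous_snd)
    refine (hΦ.continuousAt.eventually_mem (x := 0) ?_).and
      ((h2.continuousAt.eventually_mem (x := 0) ?_).and ((continuous_snd.tendsto
        (0 : ℝ × ℂ)).eventually hdisc))
    · change _ ∈ 𝓝 (Φ 0 0)
      rwa [hΦ0]
    · change _ ∈ 𝓝 (Φ 0 0)
      rwa [hΦ0]
  obtain ⟨δ, hδ, hδb⟩ := Metric.eventually_nhds_iff_ball.1 hev
  rw [hΩ.frontier_eq] at hq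
  refine hq.2 (hloc.continuity_principle hΦ hΦd hΦ0 (half_pos hδ) (half_pos hδ)
    fun t ht τ hτ h => ?_)
  obtain ⟨h1, h2, h3⟩ := hδb (t, τ) (by
    rw [mem_ball_zero_iff, Prod.norm_mk, Real.norm_of_nonneg ht.1]
    have := ht.2
    exact max_lt (by linarith) (by linarith))
  have he : Φ t τ + t • ν = q + (τ • v' + τ ^ 2 • b) := by simp [Φ]
  have he0 : Φ 0 τ = q + (τ • v' + τ ^ 2 • b) := by simp [Φ]
  have h4 := hmono _ h1 t ht.1 (by rw [he, ← he0]; exact h2)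
  rw [he] at h4
  have h5 : 0 < c' * ‖τ‖ ^ 2 ∨ 0 < t := h.symm.imp_left fun h => by
    have := norm_pos_iff.2 h
    positivity
  have h6 : 0 ≤ c' * ‖τ‖ ^ 2 := by positivity
  have h7 : ρ (Φ t τ) < 0 := by
    have := ht.1
    simp only at h3
    rcases h5 with h5 | h5 <;> linarith
  have h8 : Φ t τ ∈ Ω ∩ U := by
    rw [hΩU]
    exact ⟨(hRb _ h1).2, h7⟩
  exact h8.1

end

/-! ### Conclusion. -/

theorem proposition2p1 (n : ℕ) (Ω F : Set (EuclideanSpace ℂ (Fin n)))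
    (hΩ : IsOpen Ω)
    (hF : IsClosed F) (hFΩ : F ⊆ frontier Ω)
    (hC2 : ∀ a ∈ F, HasC2BoundaryNear Ω a)
    (hloc : ∀ ζ ∈ frontier Ω \ F, LocallyPseudoconvexAt Ω ζ)
    (hint : interior (Subtype.val ⁻¹' F : Set (frontier Ω)) = ∅) :
    IsPseudoconvex Ω := by
  refine isPseudoconvex_of_neg_log_infDist_compl hΩ fun hne =>
    ⟨continuousOn_neg_log_infDist_compl hΩ hne, fun z w hzw => ?_⟩
  by_contra! hlt
  obtain ⟨Φ, c, s, hΦ, hΦd, hc, hs, hp, hin, hball⟩ :=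
    exists_touching_discs_of_circleAverage_lt hΩ hne hzw hlt
  by_cases hpF : Φ 0 0 ∈ F
  · have hev := (hC2 _ hpF).eventually_not_locallyPseudoconvexAt hΩ hp (hΦd 0) rfl hc hs hball
    -- Failure of local pseudoconvexity near p puts a relative neighbourhood of p inside F.
    have hev' : ∀ᶠ q : frontier Ω in 𝓝 ⟨Φ 0 0, hp⟩, (q : EuclideanSpace ℂ (Fin n)) ∈ F := by
      filter_upwards [continuous_subtype_val.continuousAt.eventually hev] with q hq
      by_contra hqF
      exact hq q.2 (hloc q ⟨q.2, hqF⟩)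
    have hmem : (⟨Φ 0 0, hp⟩ : frontier Ω) ∈ interior (Subtype.val ⁻¹' F : Set (frontier Ω)) :=
      mem_interior_iff_mem_nhds.2 hev'
    rw [hint] at hmem
    exact hmem
  · have hmem := (hloc _ ⟨hp, hpF⟩).continuity_principle hΦ hΦd rfl one_pos hs hin
    rw [hΩ.frontier_eq] at hp
    exact hp.2 hmem
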